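/- **Model.** There are $n$ processes with identifiers $1,\dots,n$; a set $H$ of them is honest, and at most $t$ are faulty (Byzantine). They communicate in synchronous rounds: in each round each process sends at most one message to each process, receives the messages sent to it in that round, and updates its state. Faulty processes may send arbitrary messages (different ones to different recipients, or none); malformed messages are ignored. A broadcast is a message to all $n$ processes, the sender included, and counts as $n$ messages. A process that has returned sends nothing more. Process $i$ has an input $x_i$ from a totally ordered set, and a classification vector $c_i\in\{0,1\}^n$ (for instance, one obtained by voting on predictions), where $c_i[j]=1$ means that $i$ classifies $j$ as honest. All processes are given the same integer $k\ge 0$. A process $j$ is *misclassified* if for some honest $i$ either $j$ is honest and $c_i[j]=0$, or $j$ is faulty and $c_i[j]=1$. Let $\pi(c_i)$ be the list of the identifiers $j$ with $c_i[j]=1$ in increasing order, followed by those with $c_i[j]=0$ in increasing order. **Algorithm** (process $i$). Set $v_i\leftarrow x_i$, undecided. For $\phi=1,\dots,2k+1$ let $L_i$ be the set of identifiers in positions $(3k+1)(\phi-1)+1,\dots,(3k+1)\phi$ of $\pi(c_i)$ (positions beyond $n$ are ignored) and execute the following phase: $(v_i,g_i)\leftarrow \mathrm{GC}(v_i)$;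 $v_i'\leftarrow \mathrm{Conc}(v_i)$; if $g_i=0$ then $v_i\leftarrow v_i'$; $(v_i,g_i)\leftarrow\mathrm{GC}(v_i)$; if a decision was made in the previous phase, return it; otherwise, if $g_i=1$, decide $v_i$. After phase $2k+1$ return $v_i$. Here: * $\mathrm{GC}(v)$ (graded consensus, two rounds). Round 1: if $i\in L_i$, broadcast $v$; if some value was received from at least $2k+1$ processes in $L_i$, let $b$ be such a value, otherwise $b=\bot$. Round 2: if $i\in L_i$ and $b\ne\bot$, broadcast $b$. If $b\neq\bot$, return $(b,1)$ if $b$ was received in round 2 from at least $2k+1$ processes in $L_i$, and $(b,0)$ otherwise. If $b=\bot$, return $(w,0)$ for some value $w$ received in round 2 from at least $k+1$ processes in $L_i$ if there is one, and $(v,0)$ otherwise. * $\mathrm{Conc}(v)$ (conciliation, one round). If $i\in L_i$, broadcast $(v,L_i)$. Let $T$ be the set of processes from which a pair $(v_y,L_y)$ was received, and consider the directed graph on $T$ with an edge $(y,z)$ whenever $y\in L_z$. For $z\in T\cap L_i$ let $m[z]$ be the minimum of the $v_y$ over all $y\in T$ with $y\in L_y$ from which there is a path (possibly of length $0$) to $z$;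 it is undefined if there is no such $y$. Return a value that occurs most often among the $m[z]$, $z\in T\cap L_i$ (an arbitrary value if none is defined). Where several values qualify, any of them may be chosen. **Theorem.** There is an absolute constant $C$ such that the following holds in every execution. 1. If at most $k$ processes are misclassified and $(2k+1)(3k+1)\le n-t-k$, then all honest processes return the same value (Agreement); if all honest processes have the same input $v$, then they all return $v$ (Strong Unanimity); and the honest processes send at most $C\,n\max(k,1)^2$ messages in total (that is, $O(nk^2)$ for $k\ge1$). 2. Without the assumptions of 1, each honest process returns within $5(2k+1)$ rounds and sends at most $5n$ messages. -/

import Mathlib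

universe u v w

namespace ByzAgreement

/-! Synchronous message passing among `n` processes. -/

/-- The code of one process: either it returns a value, or it executes one more round, in which it
sends `send j` to each process `j` (`none` means that no message is sent to `j`), receives at most
one message from each process, and continues depending on the messages received. -/
inductive Program (n : ℕ) (M : Type u) (α : Type v) : Type (max u v)
  | ret (a : α) : Program n M α
  | round (send : Fin n → Option M) (next : (Fin n → Option M) → Program n M α) : Program n M α

namespace Program

variable {n : ℕ} {M : Type u} {α : Type v} {β : Type w}

/-- Sequential composition: run the first program and hand its result to the second. -/
def bind : Program n M α → (α → Program n M β) → Program n M β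
  | ret a, f => f a
  | round send next, f => round send fun inbox => bind (next inbox) f

instance : Monad (Program n M) where
  pure := ret
  bind := bind

/-- One round of communication, whose result is the vector of received messages. -/
def exchange (send : Fin n → Option M) : Program n M (Fin n → Option M) :=
  round send ret

/-- The messages sent in the next round; a process that has returned sends nothing. -/
def outgoing : Program n M α → Fin n → Option M
  | ret _ => fun _ => none
  | round send _ => send

/-- Execution of one round, with received messages `inbox`. -/
def advance : Program n M α → (Fin n → Option M) → Program n M α
  | ret a, _ => ret a
  | round _ next, inbox => next inbox

/-- The returned value, if the process has returned. -/
def output : Program n M α → Option α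
  | ret a => some a
  | round _ _ => none

end Program

section Execution

variable {n : ℕ} {M : Type u} {α : Type v}

/-- What remains to be executed by each process after `r` rounds. The processes in `H` are honest
and run `prog`. All others are Byzantine: in round `r` (counted from `0`) the faulty process `j`
sends the arbitrary message `adv r j i` (or nothing) to process `i`.
(The components with index outside `H` have no meaning and are never used.) -/
noncomputable def stateAfter (prog : Fin n → Program n M α) (H : Finset (Fin n))
    (adv : ℕ → Fin n → Fin n → Option M) : ℕ → Fin n → Program n M α
  | 0 => prog
  | r + 1 => fun i =>
      (stateAfter prog H adv r i).advance fun j =>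
        if j ∈ H then (stateAfter prog H adv r j).outgoing i else adv r j i

/-- Process `i` has returned `a` by the end of the first `r` rounds. -/
def ReturnsBy (prog : Fin n → Program n M α) (H : Finset (Fin n))
    (adv : ℕ → Fin n → Fin n → Option M) (r : ℕ) (i : Fin n) (a : α) : Prop :=
  (stateAfter prog H adv r i).output = some a

/-- The number of messages that process `i` sends during the whole (infinite) execution. Each
message to each recipient counts, so that a broadcast amounts to `n` messages. -/
noncomputable def messagesSent (prog : Fin n → Program n M α) (H : Finset (Fin n))
    (adv : ℕ → Fin n → Fin n → Option M) (i : Fin n) : ℕ∞ :=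
  {p : ℕ × Fin n | (stateAfter prog H adv p.1 i).outgoing p.2 ≠ none}.encard

/-- Agreement: all honest processes return, and they return the same value. -/
def Agreement (prog : Fin n → Program n M α) (H : Finset (Fin n))
    (adv : ℕ → Fin n → Fin n → Option M) : Prop :=
  ∃ a, ∀ i ∈ H, ∃ r, ReturnsBy prog H adv r i a

/-- Strong unanimity: if all honest processes have the same input `a`, then they all return `a`. -/
def StrongUnanimity (x : Fin n → α) (prog : Fin n → Program n M α) (H : Finset (Fin n))
    (adv : ℕ → Fin n → Fin n → Option M) : Prop :=
  ∀ a, (∀ i ∈ H, x i = a) → ∀ i ∈ H, ∃ r, ReturnsBy prog H adv r i a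

end Execution

/-! Classification vectors: `c i j = true` means that process `i` classifies `j` as honest. -/

/-- The ordering `π(c)`: the identifiers classified as honest, in increasing order, followed by
the identifiers classified as faulty, in increasing order. -/
def order {n : ℕ} (c : Fin n → Bool) : List (Fin n) :=
  (List.finRange n).filter (fun j => c j) ++ (List.finRange n).filter (fun j => !c j)

/-- The block of `3k+1` consecutive identifiers of `π(c)` that is used in phase `φ`, where phases
are counted from `0`: positions `(3k+1)φ + 1, …, (3k+1)(φ+1)`, as far as they exist. -/
def block {n : ℕ} (c : Fin n → Bool) (k φ : ℕ) : Finset (Fin n) :=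
  (((order c).drop ((3 * k + 1) * φ)).take (3 * k + 1)).toFinset

open Classical in
/-- The processes that are misclassified by at least one honest process: honest processes
classified as faulty, and faulty processes classified as honest. -/
noncomputable def misclassified {n : ℕ} (H : Finset (Fin n)) (c : Fin n → Fin n → Bool) :
    Finset (Fin n) :=
  {j | ∃ i ∈ H, ¬(c i j = true ↔ j ∈ H)}

/-! The algorithm. -/

/-- The messages: a value, or a value together with a set of identifiers. -/
inductive Msg (n : ℕ) (V : Type u) : Type u
  | value (v : V) : Msg n V
  | proposal (v : V) (L : Finset (Fin n)) : Msg n V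

section Algorithm

variable {n : ℕ} {V : Type u}

/-- Where the pseudocode takes "a value" with some property, any such value may be taken. This is
resolved by a function `pick` which returns an element of every nonempty set of candidates. Its
value at the empty set is unconstrained. -/
def IsChoice (pick : Set V → V) : Prop :=
  ∀ S : Set V, S.Nonempty → pick S ∈ S

/-- Process `i` sends `m` to all processes (including itself) if `i ∈ L`, and otherwise nothing. -/
def broadcastIfMem (i : Fin n) (L : Finset (Fin n)) (m : Msg n V) : Fin n → Option (Msg n V) :=
  fun _ => if i ∈ L then some m else none

open Classical in
/-- The number of processes in `L` from which the value `v` was received. -/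
noncomputable def occurrences (L : Finset (Fin n)) (inbox : Fin n → Option (Msg n V)) (v : V) : ℕ :=
  (L.filter fun j => inbox j = some (Msg.value v)).card

open Classical in
/-- Graded consensus with core set, for process `i` with input `v` and listening set `L`.
It takes two rounds. The grade `1` is `true`, the grade `0` is `false`. -/
noncomputable def gradedConsensus (i : Fin n) (k : ℕ) (L : Finset (Fin n)) (pick₁ pick₂ : Set V → V)
    (v : V) : Program n (Msg n V) (V × Bool) := do
  let R ← Program.exchange (broadcastIfMem i L (Msg.value v))
  let S : Set V := {w | 2 * k + 1 ≤ occurrences L R w}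
  let b : Option V := if S.Nonempty then some (pick₁ S) else none
  let R' ← Program.exchange (match b with
    | some w => broadcastIfMem i L (Msg.value w)
    | none => fun _ => none)
  let S' : Set V := {w | k + 1 ≤ occurrences L R' w}
  match b with
  | some w => pure (w, decide (2 * k + 1 ≤ occurrences L R' w))
  | none => if S'.Nonempty then pure (pick₂ S', false) else pure (v, false)

/-- The edge `(y, z)` of the leader graph: messages from both `y` and `z` were received, and `y` is
a member of the set `L_z` sent by `z`. -/
def LeaderEdge (inbox : Fin n → Option (Msg n V)) (y z : Fin n) : Prop :=
  (∃ v A, inbox y = some (Msg.proposal v A)) ∧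
    ∃ v A, inbox z = some (Msg.proposal v A) ∧ y ∈ A

/-- The values `v_y` received from those `y ∈ L_y` from which there is a path (possibly of length
zero) to `z` in the leader graph. -/
def reachingValues (inbox : Fin n → Option (Msg n V)) (z : Fin n) : Set V :=
  {v | ∃ y A, inbox y = some (Msg.proposal v A) ∧ y ∈ A ∧
    Relation.ReflTransGen (LeaderEdge inbox) y z}

variable [LinearOrder V]

open Classical in
/-- The number of `z ∈ L` from which a message was received and for which `m[z] = v`, where `m[z]`
is the least of the values that reach `z`. (If there is none, `m[z]` is undefined.) -/
noncomputable def minOccurrences (L : Finset (Fin n)) (inbox : Fin n → Option (Msg n V)) (v : V) :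
    ℕ :=
  (L.filter fun z => (∃ w A, inbox z = some (Msg.proposal w A)) ∧
    IsLeast (reachingValues inbox z) v).card

/-- Conciliation, for process `i` with input `v` and listening set `L`. It takes one round, and
returns a value that occurs most frequently among the `m[z]`. -/
noncomputable def conciliate (i : Fin n) (L : Finset (Fin n)) (pick : Set V → V) (v : V) :
    Program n (Msg n V) V := do
  let R ← Program.exchange (broadcastIfMem i L (Msg.proposal v L))
  pure (pick {w | 0 < minOccurrences L R w ∧ ∀ u, minOccurrences L R u ≤ minOccurrences L R w})

/-- The last `m` phases of the main loop, starting with phase `φ` (counted from `0`), for process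
`i` with classification vector `c`, current value `v`, and `decision` equal to `some d` if `d` has
been decided and to `none` if nothing has been decided yet. The round with number `r` uses `pick r`
for its choice, and phase `φ` consists of the rounds `5φ, …, 5φ + 4`. -/
noncomputable def phases (i : Fin n) (c : Fin n → Bool) (k : ℕ) (pick : ℕ → Set V → V) :
    (m φ : ℕ) → (v : V) → (decision : Option V) → Program n (Msg n V) V
  | 0, _, v, _ => pure v
  | m + 1, φ, v, decision => do
      let L := block c k φ
      let a ← gradedConsensus i k L (pick (5 * φ)) (pick (5 * φ + 1)) v
      let v' ← conciliate i L (pick (5 * φ + 2)) a.1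
      let b ← gradedConsensus i k L (pick (5 * φ + 3)) (pick (5 * φ + 4))
        (if a.2 = true then a.1 else v')
      match decision with
      | some d => pure d
      | none => phases i c k pick m (φ + 1) b.1 (if b.2 = true then some b.1 else none)

/-- Unauthenticated Byzantine agreement with classification, for process `i` with input `x`,
classification vector `c` and parameter `k`: at most `2k+1` phases. -/
noncomputable def baWithClassification (k : ℕ) (pick : ℕ → Set V → V) (i : Fin n) (x : V)
    (c : Fin n → Bool) : Program n (Msg n V) V :=
  phases i c k pick (2 * k + 1) 0 x none

/-- All processes run the algorithm, process `i` with input `x i` and classification `c i`. -/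
noncomputable def baSystem (k : ℕ) (pick : Fin n → ℕ → Set V → V) (x : Fin n → V)
    (c : Fin n → Fin n → Bool) : Fin n → Program n (Msg n V) V :=
  fun i => baWithClassification k (pick i) i (x i) (c i)

end Algorithm

end ByzAgreement

open ByzAgreement

namespace ByzAgreement

/-! ### Positions in the orderings `order (c i)`, cores and clean phases -/

section Blocks

variable {n : ℕ}

/-! Let A be the set of honest processes that no honest process misclassifies. An honest i
classifies as honest all of A and otherwise only misclassified processes, so a process it classifies
as honest has a position in its ordering between its rank in A and that rank plus k. The bound on n
makes A large enough to fill all 2k+1 blocks. Two facts follow: the members of A whose ranks are the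
first 2k+1 of a block are in everyone's listening set (`exists_isCore`), and each misclassified
process touches at most two blocks, so one of the 2k+1 phases is clean, with honest listeners only
(`exists_phase_block_subset`).

In a listening set of size at most 3k+1, two quorums of 2k+1 meet in the core, even across
receivers. This gives graded consensus its unanimity and coherence (`stateAfter_gradedConsensus`).
In a clean phase all core members have the same minimum and outvote the rest, so conciliation
unifies the values (`stateAfter_conciliate`) and the second graded consensus gives grade 1
everywhere. Once some honest process gets grade 1, all honest values coincide, and the next phase
preserves this (`exists_ret_agreement`). Only processes occurring in one of their own blocks send
anything; they are O(k²) in number, and each does so in a single phase. -/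

theorem _root_.List.idxOf_eq_length_filter_lt {α : Type*} [LinearOrder α] {l : List α}
    (hl : l.Pairwise (· < ·)) {a : α} (ha : a ∈ l) :
    l.idxOf a = (l.filter (· < a)).length := by
  induction l with
  | nil => simp at ha
  | cons b l ih =>
    rw [List.pairwise_cons] at hl
    by_cases hab : b = a
    · subst hab
      have : l.filter (· < b) = [] := by
        rw [List.filter_eq_nil_iff]
        intro x hx
        simpa using (hl.1 x hx).le
      simp [this]
    · have ha' : a ∈ l := by
        rcases List.mem_cons.1 ha with h | h
        · exact absurd h.symm hab
        · exact h
      have hba : b < a := hl.1 a ha'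
      rw [List.idxOf_cons_ne _ hab, ih hl.2 ha', List.filter_cons_of_pos (by simpa using hba)]
      simp

theorem nodup_order (c : Fin n → Bool) : (order c).Nodup := by
  unfold order
  refine List.Nodup.append ((List.nodup_finRange n).filter _) ((List.nodup_finRange n).filter _) ?_
  intro j h1 h2
  simp at h1 h2
  simp [h1] at h2

theorem mem_order (c : Fin n → Bool) (j : Fin n) : j ∈ order c := by
  unfold order
  cases h : c j <;> simp [h]

theorem length_filter_finRange (p : Fin n → Bool) :
    ((List.finRange n).filter p).length = (Finset.univ.filter fun j => p j = true).card := by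
  rw [← List.toFinset_card_of_nodup ((List.nodup_finRange n).filter _)]
  congr 1
  ext j
  simp

theorem idxOf_order_of_true {c : Fin n → Bool} {j : Fin n} (hj : c j = true) :
    (order c).idxOf j = (Finset.univ.filter fun y => c y = true ∧ y < j).card := by
  have hmem : j ∈ (List.finRange n).filter (fun j => c j) := by simp [hj]
  unfold order
  rw [List.idxOf_append_of_mem hmem, List.idxOf_eq_length_filter_lt
    ((List.pairwise_lt_finRange n).filter _) hmem, List.filter_filter, length_filter_finRange]
  congr 1
  ext y
  simp [and_comm]

theorem card_le_idxOf_order_of_false {c : Fin n → Bool} {j : Fin n} (hj : c j = false) :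
    (Finset.univ.filter fun y => c y = true).card ≤ (order c).idxOf j := by
  have hmem : j ∉ (List.finRange n).filter (fun j => c j) := by simp [hj]
  unfold order
  rw [List.idxOf_append_of_notMem hmem, length_filter_finRange]
  omega

/-- Viewing blocks as fibres of a quotient makes their disjointness immediate and turns the shift by
at most k into arithmetic of division. -/
theorem mem_block_iff {c : Fin n → Bool} {k φ : ℕ} {j : Fin n} :
    j ∈ block c k φ ↔ (order c).idxOf j / (3 * k + 1) = φ := by
  have hnd := nodup_order c
  have key : j ∈ block c k φ ↔
      (3 * k + 1) * φ ≤ (order c).idxOf j ∧ (order c).idxOf j < (3 * k + 1) * φ + (3 * k + 1) := by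
    unfold block
    rw [List.mem_toFinset, List.mem_take_iff_getElem]
    constructor
    · rintro ⟨m, hm, rfl⟩
      rw [List.length_drop] at hm
      rw [List.getElem_drop, hnd.idxOf_getElem]
      omega
    · rintro ⟨h1, h2⟩
      have h3 : (order c).idxOf j < (order c).length := List.idxOf_lt_length_iff.2 (mem_order c j)
      refine ⟨(order c).idxOf j - (3 * k + 1) * φ, ?_, ?_⟩
      · rw [List.length_drop]
        omega
      · rw [List.getElem_drop]
        simp [Nat.add_sub_cancel' h1]
  rw [key, Nat.div_eq_iff (by omega), mul_comm φ]
  omega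

theorem card_block_le (c : Fin n → Bool) (k φ : ℕ) : (block c k φ).card ≤ 3 * k + 1 := by
  unfold block
  exact (List.toFinset_card_le _).trans (by simp)

/-- The number of elements of `A` below `j`. -/
def rankIn (A : Finset (Fin n)) (j : Fin n) : ℕ := (A.filter (· < j)).card

theorem rankIn_lt_rankIn {A : Finset (Fin n)} {i j : Fin n} (hi : i ∈ A) (hij : i < j) :
    rankIn A i < rankIn A j := by
  refine Finset.card_lt_card (Finset.ssubset_iff_subset_ne.2 ⟨?_, ?_⟩)
  · intro y hy
    simp only [Finset.mem_filter] at hy ⊢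
    exact ⟨hy.1, hy.2.trans hij⟩
  · intro h
    have : i ∈ A.filter (· < i) := by
      rw [h]
      simp [hi, hij]
    simp at this

theorem rankIn_injOn (A : Finset (Fin n)) : Set.InjOn (rankIn A) A := by
  intro i hi j hj h
  rcases lt_trichotomy i j with hij | hij | hij
  · exact absurd h (rankIn_lt_rankIn hi hij).ne
  · exact hij
  · exact absurd h (rankIn_lt_rankIn hj hij).ne'

theorem rankIn_lt_card {A : Finset (Fin n)} {i : Fin n} (hi : i ∈ A) : rankIn A i < A.card := by
  refine Finset.card_lt_card (Finset.filter_ssubset.2 ⟨i, hi, by simp⟩)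

theorem image_rankIn (A : Finset (Fin n)) : A.image (rankIn A) = Finset.range A.card := by
  refine Finset.eq_of_subset_of_card_le ?_ ?_
  · intro m hm
    obtain ⟨i, hi, rfl⟩ := Finset.mem_image.1 hm
    exact Finset.mem_range.2 (rankIn_lt_card hi)
  · rw [Finset.card_image_of_injOn (rankIn_injOn A), Finset.card_range]

theorem card_filter_rankIn {A : Finset (Fin n)} {a b : ℕ} (hb : b ≤ A.card) :
    (A.filter fun j => a ≤ rankIn A j ∧ rankIn A j < b).card = b - a := by
  have h : (A.filter fun j => a ≤ rankIn A j ∧ rankIn A j < b).image (rankIn A)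
      = Finset.Ico a b := by
    ext m
    simp only [Finset.mem_image, Finset.mem_filter, Finset.mem_Ico]
    constructor
    · rintro ⟨j, ⟨-, h⟩, rfl⟩
      exact h
    · rintro ⟨h1, h2⟩
      have : m ∈ A.image (rankIn A) := by
        rw [image_rankIn]
        exact Finset.mem_range.2 (by omega)
      obtain ⟨j, hj, rfl⟩ := Finset.mem_image.1 this
      exact ⟨j, ⟨hj, h1, h2⟩, rfl⟩
  rw [← Nat.card_Ico, ← h, Finset.card_image_of_injOn]
  exact (rankIn_injOn A).mono (Finset.coe_subset.2 (Finset.filter_subset _ _))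

/-- Conditions on the listening sets `L i` of the processes `i ∈ H` in one phase: they have at most
`3k+1` elements, of which at most `k` are faulty, and share the honest processes in `C`, of which
there are at least `2k+1`. -/
structure IsCore (H : Finset (Fin n)) (k : ℕ) (L : Fin n → Finset (Fin n))
    (C : Finset (Fin n)) : Prop where
  subset_honest : C ⊆ H
  subset_listen : ∀ i ∈ H, C ⊆ L i
  card_listen_le : ∀ i ∈ H, (L i).card ≤ 3 * k + 1
  card_faulty_le : ∀ i ∈ H, (L i \ H).card ≤ k
  le_card : 2 * k + 1 ≤ C.card

variable {H : Finset (Fin n)} {c : Fin n → Fin n → Bool} {k t : ℕ}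

theorem classified_of_mem_sdiff {i j : Fin n} (hi : i ∈ H) (hj : j ∈ H \ misclassified H c) :
    c i j = true := by
  rw [Finset.mem_sdiff, misclassified, Finset.mem_filter] at hj
  by_contra h
  exact hj.2 ⟨Finset.mem_univ _, i, hi, fun h' => h (h'.2 hj.1)⟩

theorem mem_sdiff_or_mem_of_classified {i j : Fin n} (hi : i ∈ H) (hj : c i j = true) :
    j ∈ H \ misclassified H c ∨ j ∈ misclassified H c := by
  by_cases hm : j ∈ misclassified H c
  · exact Or.inr hm
  · refine Or.inl (Finset.mem_sdiff.2 ⟨?_, hm⟩)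
    by_contra hjH
    refine hm ?_
    rw [misclassified, Finset.mem_filter]
    exact ⟨Finset.mem_univ _, i, hi, fun h => hjH (h.1 hj)⟩

/-- Every smaller member of A precedes j; in `idxOf_le_rankIn_add`, only misclassified processes can
precede it in addition. -/
theorem rankIn_le_idxOf {i j : Fin n} (hi : i ∈ H) (hj : c i j = true) :
    rankIn (H \ misclassified H c) j ≤ (order (c i)).idxOf j := by
  rw [idxOf_order_of_true hj]
  refine Finset.card_le_card fun y hy => ?_
  rw [Finset.mem_filter] at hy
  exact Finset.mem_filter.2 ⟨Finset.mem_univ _, classified_of_mem_sdiff hi hy.1, hy.2⟩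

theorem idxOf_le_rankIn_add {i j : Fin n} (hi : i ∈ H) (hj : c i j = true)
    (hk : (misclassified H c).card ≤ k) :
    (order (c i)).idxOf j ≤ rankIn (H \ misclassified H c) j + k := by
  rw [idxOf_order_of_true hj]
  refine le_trans (Finset.card_le_card (t := (H \ misclassified H c).filter (· < j) ∪
    misclassified H c) fun y hy => ?_) ((Finset.card_union_le _ _).trans ?_)
  · rw [Finset.mem_filter] at hy
    rw [Finset.mem_union, Finset.mem_filter]
    exact (mem_sdiff_or_mem_of_classified hi hy.2.1).imp (fun h => ⟨h, hy.2.2⟩) id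
  · unfold rankIn
    omega

theorem le_card_sdiff_misclassified (ht : Hᶜ.card ≤ t) (hk : (misclassified H c).card ≤ k)
    (hn : (2 * (k : ℤ) + 1) * (3 * k + 1) ≤ n - t - k) :
    (2 * k + 1) * (3 * k + 1) ≤ (H \ misclassified H c).card := by
  have h1 := Finset.le_card_sdiff (misclassified H c) H
  have h2 := Finset.card_add_card_compl H
  rw [Fintype.card_fin] at h2
  zify at *
  have : ((H.card - (misclassified H c).card : ℕ) : ℤ) ≥ H.card - (misclassified H c).card := by
    omega
  linarith

/-- Identifiers classified as faulty come after all of A, hence beyond the last block in use. -/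
theorem classified_of_mem_block
    (hA : (2 * k + 1) * (3 * k + 1) ≤ (H \ misclassified H c).card) {φ : ℕ} (hφ : φ < 2 * k + 1)
    {i j : Fin n} (hi : i ∈ H) (hj : j ∈ block (c i) k φ) : c i j = true := by
  by_contra h
  have h1 := card_le_idxOf_order_of_false (Bool.eq_false_iff.2 h)
  have h2 : (H \ misclassified H c).card ≤ (Finset.univ.filter fun y => c i y = true).card :=
    Finset.card_le_card fun y hy =>
      Finset.mem_filter.2 ⟨Finset.mem_univ _, classified_of_mem_sdiff hi hy⟩
  have h3 : (order (c i)).idxOf j < (2 * k + 1) * (3 * k + 1) := by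
    rw [← Nat.div_lt_iff_lt_mul (by omega), mem_block_iff.1 hj]
    exact hφ
  omega

theorem exists_isCore (hk : (misclassified H c).card ≤ k)
    (hA : (2 * k + 1) * (3 * k + 1) ≤ (H \ misclassified H c).card) {φ : ℕ} (hφ : φ < 2 * k + 1) :
    ∃ C, IsCore H k (fun i => block (c i) k φ) C := by
  -- The first 2k+1 ranks of the block: a shift by at most k cannot leave a block of length 3k+1.
  refine ⟨(H \ misclassified H c).filter fun j => (3 * k + 1) * φ ≤ rankIn (H \ misclassified H c) j
    ∧ rankIn (H \ misclassified H c) j < (3 * k + 1) * φ + (2 * k + 1), ?_, ?_, ?_, ?_, ?_⟩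
  · intro j hj
    exact (Finset.mem_sdiff.1 (Finset.mem_filter.1 hj).1).1
  · intro i hi j hj
    rw [Finset.mem_filter] at hj
    have hc := classified_of_mem_sdiff hi hj.1
    have h1 := rankIn_le_idxOf hi hc
    have h2 := idxOf_le_rankIn_add hi hc hk
    rw [mem_block_iff, Nat.div_eq_iff (by omega), mul_comm φ]
    omega
  · exact fun i _ => card_block_le _ _ _
  · intro i hi
    refine (Finset.card_le_card fun j hj => ?_).trans hk
    rw [Finset.mem_sdiff] at hj
    refine (mem_sdiff_or_mem_of_classified hi (classified_of_mem_block hA hφ hi hj.1)).resolve_left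
      fun h => hj.2 (Finset.mem_sdiff.1 h).1
  · rw [card_filter_rankIn]
    · omega
    · refine le_trans ?_ hA
      have : (3 * k + 1) * (φ + 1) ≤ (3 * k + 1) * (2 * k + 1) := Nat.mul_le_mul_left _ hφ
      nlinarith

/-- Each misclassified process affects at most two phases, so that some phase is unaffected. -/
theorem exists_phase_block_subset (hk : (misclassified H c).card ≤ k)
    (hA : (2 * k + 1) * (3 * k + 1) ≤ (H \ misclassified H c).card) :
    ∃ φ < 2 * k + 1, ∀ i ∈ H, block (c i) k φ ⊆ H := by
  set A := H \ misclassified H c with hAdef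
  -- The position of j lies in an interval of k+1 integers starting at its rank, so its block is
  -- that of one of the endpoints. This excludes at most 2k of the 2k+1 phases.
  let bad : Finset ℕ := (misclassified H c).image (fun j => rankIn A j / (3 * k + 1)) ∪
    (misclassified H c).image (fun j => (rankIn A j + k) / (3 * k + 1))
  have hbad : bad.card < (Finset.range (2 * k + 1)).card := by
    have h1 := Finset.card_union_le ((misclassified H c).image (fun j => rankIn A j / (3 * k + 1)))
      ((misclassified H c).image (fun j => (rankIn A j + k) / (3 * k + 1)))
    have h2 := Finset.card_image_le (s := misclassified H c)
      (f := fun j => rankIn A j / (3 * k + 1))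
    have h3 := Finset.card_image_le (s := misclassified H c)
      (f := fun j => (rankIn A j + k) / (3 * k + 1))
    rw [Finset.card_range]
    exact h1.trans_lt (by omega)
  obtain ⟨φ, hφ, hφbad⟩ := Finset.exists_mem_notMem_of_card_lt_card hbad
  rw [Finset.mem_range] at hφ
  refine ⟨φ, hφ, fun i hi j hj => ?_⟩
  have hc := classified_of_mem_block hA hφ hi hj
  refine (Finset.mem_sdiff.1 ((mem_sdiff_or_mem_of_classified hi hc).resolve_right fun hm => ?_)).1
  apply hφbad
  have h1 := rankIn_le_idxOf hi hc
  have h2 := idxOf_le_rankIn_add hi hc hk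
  rw [← hAdef] at h1 h2
  have h3 := mem_block_iff.1 hj
  have h4 : rankIn A j / (3 * k + 1) ≤ φ := h3 ▸ Nat.div_le_div_right h1
  have h5 : φ ≤ (rankIn A j + k) / (3 * k + 1) := h3 ▸ Nat.div_le_div_right h2
  have h6 : (rankIn A j + k) / (3 * k + 1) ≤ rankIn A j / (3 * k + 1) + 1 := by
    rw [← Nat.add_div_right _ (by omega : 0 < 3 * k + 1)]
    exact Nat.div_le_div_right (by omega)
  rw [Finset.mem_union, Finset.mem_image, Finset.mem_image]
  rcases Nat.lt_or_ge (rankIn A j / (3 * k + 1)) φ with h | h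
  · exact Or.inr ⟨j, hm, by omega⟩
  · exact Or.inl ⟨j, hm, by omega⟩

theorem card_filter_mem_block_le (hk : (misclassified H c).card ≤ k)
    (hA : (2 * k + 1) * (3 * k + 1) ≤ (H \ misclassified H c).card) :
    (H.filter fun i => ∃ φ < 2 * k + 1, i ∈ block (c i) k φ).card ≤
      (2 * k + 1) * (3 * k + 1) + k := by
  refine le_trans (Finset.card_le_card (t := ((H \ misclassified H c).filter fun j =>
      0 ≤ rankIn (H \ misclassified H c) j ∧
      rankIn (H \ misclassified H c) j < (2 * k + 1) * (3 * k + 1)) ∪ misclassified H c) ?_)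
    ((Finset.card_union_le _ _).trans ?_)
  · intro i hi
    obtain ⟨hiH, φ, hφ, hb⟩ := Finset.mem_filter.1 hi
    have hc := classified_of_mem_block hA hφ hiH hb
    rw [Finset.mem_union, Finset.mem_filter]
    refine (mem_sdiff_or_mem_of_classified hiH hc).imp (fun h => ⟨h, Nat.zero_le _, ?_⟩) id
    refine (rankIn_le_idxOf hiH hc).trans_lt ?_
    rw [← Nat.div_lt_iff_lt_mul (by omega), mem_block_iff.1 hb]
    exact hφ
  · rw [card_filter_rankIn hA]
    omega

theorem card_filter_mem_block_le_one (c : Fin n → Bool) (k : ℕ) (i : Fin n) (s : Finset ℕ) :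
    (s.filter fun φ => i ∈ block c k φ).card ≤ 1 := by
  refine Finset.card_le_one.2 fun a ha b hb => ?_
  rw [Finset.mem_filter, mem_block_iff] at ha hb
  exact ha.2.symm.trans hb.2

end Blocks

/-! ### Bounds on rounds and messages -/

namespace Program

variable {n : ℕ} {M : Type u} {α : Type v} {β : Type w}

open Classical in
/-- Whatever messages it receives, the program halts within `T` rounds, sends at most `N` messages,
and returns a value satisfying `P`. -/
inductive HaltsWithin (P : α → Prop) : Program n M α → ℕ → ℕ → Prop
  | ret (a : α) (T N : ℕ) (h : P a) : HaltsWithin P (ret a) T N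
  | round (send : Fin n → Option M) (next : (Fin n → Option M) → Program n M α) (T N s : ℕ)
      (hs : (Finset.univ.filter fun j => send j ≠ none).card ≤ s)
      (hnext : ∀ R, HaltsWithin P (next R) T N) : HaltsWithin P (round send next) (T + 1) (s + N)

theorem HaltsWithin.bind {P : α → Prop} {Q : β → Prop} {p : Program n M α}
    {f : α → Program n M β} {T N T' N' : ℕ} (hp : HaltsWithin P p T N)
    (hf : ∀ a, P a → HaltsWithin Q (f a) T' N') : HaltsWithin Q (p.bind f) (T + T') (N + N') := by
  induction hp with
  | ret a T N h =>
    -- An early return leaves part of the budget unused, so the bounds for the continuation have to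
    -- be relaxed.
    have mono : ∀ {q : Program n M β} {T N : ℕ}, HaltsWithin Q q T N → ∀ S K,
        HaltsWithin Q q (S + T) (K + N) := by
      intro q T N hq
      induction hq with
      | ret a T N h => exact fun S K => .ret a _ _ h
      | round send next T N s hs _ ih =>
        intro S K
        have := HaltsWithin.round (P := Q) send next (S + T) (K + N) s hs fun R => ih R S K
        convert this using 1 <;> omega
    exact mono (hf a h) T N
  | round send next T N s hs _ ih =>
    have := HaltsWithin.round (P := Q) send (fun R => (next R).bind f) (T + T') (N + N') s hs
      fun R => ih R
    rwa [add_right_comm, ← add_assoc] at this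

theorem haltsWithin_exchange {send : Fin n → Option M} {s : ℕ}
    (hs : ∀ j, send j ≠ none → n ≤ s) :
    HaltsWithin (fun _ => True) (exchange send) 1 s := by
  refine HaltsWithin.round send _ 0 0 s ?_ fun R => .ret _ _ _ trivial
  by_cases h : ∃ j, send j ≠ none
  · obtain ⟨j, hj⟩ := h
    exact (Finset.card_le_univ _).trans (by simpa using hs j hj)
  · push Not at h
    simp [h]

end Program

open Program

section Execution

variable {n : ℕ} {M : Type u} {α : Type v}

/-- The messages that process `i` receives in round `r`. -/
noncomputable def received (prog : Fin n → Program n M α) (H : Finset (Fin n))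
    (adv : ℕ → Fin n → Fin n → Option M) (r : ℕ) (i j : Fin n) : Option M :=
  if j ∈ H then (stateAfter prog H adv r j).outgoing i else adv r j i

variable {prog : Fin n → Program n M α} {H : Finset (Fin n)}
  {adv : ℕ → Fin n → Fin n → Option M} {i : Fin n} {r : ℕ}

theorem stateAfter_succ :
    stateAfter prog H adv (r + 1) i =
      (stateAfter prog H adv r i).advance (received prog H adv r i) := rfl

theorem stateAfter_add_of_ret {a : α} (h : stateAfter prog H adv r i = .ret a) (s : ℕ) :
    stateAfter prog H adv (r + s) i = .ret a := by
  induction s with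
  | zero => exact h
  | succ s ih => rw [← add_assoc, stateAfter_succ, ih]; rfl

theorem HaltsWithin.exists_output {P : α → Prop} {T N : ℕ}
    (h : HaltsWithin P (stateAfter prog H adv r i) T N) :
    ∃ s ≤ T, ∃ a, P a ∧ stateAfter prog H adv (r + s) i = .ret a := by
  generalize hp : stateAfter prog H adv r i = p at h
  induction h generalizing r with
  | ret a T N h => exact ⟨0, Nat.zero_le _, a, h, hp⟩
  | round send next T N s hs _ ih =>
    obtain ⟨m, hm, a, ha, h⟩ := ih (received prog H adv r i) (r := r + 1)
      (by rw [stateAfter_succ, hp]; rfl)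
    exact ⟨m + 1, by omega, a, ha, by rw [← h]; congr 1; omega⟩

/-- Counting only from round r on lets the induction peel off one round at a time. -/
theorem HaltsWithin.encard_le {P : α → Prop} {T N : ℕ}
    (h : HaltsWithin P (stateAfter prog H adv r i) T N) :
    {p : ℕ × Fin n | r ≤ p.1 ∧ (stateAfter prog H adv p.1 i).outgoing p.2 ≠ none}.encard ≤ N := by
  generalize hp : stateAfter prog H adv r i = p at h
  induction h generalizing r with
  | ret a T N h =>
    have : {p : ℕ × Fin n | r ≤ p.1 ∧ (stateAfter prog H adv p.1 i).outgoing p.2 ≠ none} = ∅ := by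
      ext ⟨m, j⟩
      simp only [Set.mem_ofPred_eq, Set.mem_empty_iff_false, iff_false, not_and, not_not]
      intro hm
      obtain ⟨s, rfl⟩ := Nat.exists_eq_add_of_le hm
      rw [stateAfter_add_of_ret hp]
      rfl
    simp [this]
  | round send next T N s hs _ ih =>
    have ih' := ih (received prog H adv r i) (r := r + 1) (by rw [stateAfter_succ, hp]; rfl)
    have hsub : {p : ℕ × Fin n | r ≤ p.1 ∧ (stateAfter prog H adv p.1 i).outgoing p.2 ≠ none} ⊆
        (Prod.mk r) '' {j | send j ≠ none} ∪
        {p | r + 1 ≤ p.1 ∧ (stateAfter prog H adv p.1 i).outgoing p.2 ≠ none} := by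
      rintro ⟨m, j⟩ ⟨h1, h2⟩
      rcases Nat.eq_or_lt_of_le h1 with h | h
      · left
        dsimp only at h h2
        subst h
        rw [hp] at h2
        exact ⟨j, h2, rfl⟩
      · exact Or.inr ⟨h, h2⟩
    refine (Set.encard_le_encard hsub).trans ((Set.encard_union_le _ _).trans ?_)
    push_cast
    refine add_le_add ((Set.encard_image_le _ _).trans ?_) ih'
    rw [← Set.coe_toFinset {j | send j ≠ none}, Set.encard_coe_eq_coe_finsetCard]
    refine Nat.cast_le.2 (le_trans (le_of_eq ?_) hs)
    congr 1
    ext j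
    simp

theorem HaltsWithin.messagesSent_le {P : α → Prop} {T N : ℕ} (h : HaltsWithin P (prog i) T N) :
    messagesSent prog H adv i ≤ N := by
  have := HaltsWithin.encard_le (H := H) (adv := adv) (r := 0) h
  simp only [Nat.zero_le, true_and] at this
  exact this

end Execution

section Cost

variable {n : ℕ} {V : Type u} {i : Fin n} {k : ℕ} {L : Finset (Fin n)}

theorem haltsWithin_gradedConsensus (p₁ p₂ : Set V → V) (v : V) :
    HaltsWithin (fun _ => True) (gradedConsensus i k L p₁ p₂ v) 2 (if i ∈ L then 2 * n else 0) := by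
  have hb : ∀ m : Msg n V, ∀ j, broadcastIfMem i L m j ≠ none → n ≤ if i ∈ L then n else 0 := by
    intro m j h
    by_cases hi : i ∈ L
    · simp [hi]
    · simp [broadcastIfMem, hi] at h
  have hsum : (if i ∈ L then 2 * n else 0) =
      (if i ∈ L then n else 0) + ((if i ∈ L then n else 0) + 0) := by
    split_ifs <;> omega
  rw [hsum]
  unfold gradedConsensus
  refine (haltsWithin_exchange (hb _)).bind (T' := 1) fun R _ => ?_
  refine (haltsWithin_exchange ?_).bind (T' := 0) fun R' _ => ?_
  · split
    · exact hb _
    · simp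
  · split
    · exact .ret _ _ _ trivial
    · dsimp only
      split_ifs
      · exact .ret _ _ _ trivial
      · exact .ret _ _ _ trivial

variable [LinearOrder V]

theorem haltsWithin_conciliate (p : Set V → V) (v : V) :
    HaltsWithin (fun _ => True) (conciliate i L p v) 1 (if i ∈ L then n else 0) := by
  unfold conciliate
  refine (haltsWithin_exchange (s := if i ∈ L then n else 0) ?_).bind (T' := 0) (N' := 0)
    fun R _ => .ret _ _ _ trivial
  intro j h
  by_cases hi : i ∈ L
  · simp [hi]
  · simp [broadcastIfMem, hi] at h

/-- The continuation is arbitrary, so that this covers both a phase that ends by returning a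
decision and one that is followed by others. -/
theorem haltsWithin_phases_step {β : Type w} {Q : β → Prop} {T N : ℕ} {p₁ p₂ p₃ p₄ p₅ : Set V → V} {v : V}
    {f : V × Bool → Program n (Msg n V) β} (hf : ∀ b, HaltsWithin Q (f b) T N) :
    HaltsWithin Q ((gradedConsensus i k L p₁ p₂ v).bind fun a =>
      (conciliate i L p₃ a.1).bind fun v' =>
      (gradedConsensus i k L p₄ p₅ (if a.2 = true then a.1 else v')).bind f)
      (5 + T) ((if i ∈ L then 5 * n else 0) + N) := by
  have h := (haltsWithin_gradedConsensus (i := i) (k := k) (L := L) p₁ p₂ v).bind fun a _ =>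
    (haltsWithin_conciliate (i := i) (L := L) p₃ a.1).bind fun v' _ =>
    (haltsWithin_gradedConsensus (i := i) (k := k) (L := L) p₄ p₅
      (if a.2 = true then a.1 else v')).bind fun b _ => hf b
  convert h using 1
  · omega
  · split_ifs <;> omega

theorem haltsWithin_phases (c : Fin n → Bool) (pick : ℕ → Set V → V) (m φ : ℕ) (v : V)
    (dec : Option V) :
    HaltsWithin (fun _ => True) (phases i c k pick m φ v dec) (5 * m)
      (5 * n * ((Finset.Ico φ (φ + m)).filter fun ψ => i ∈ block c k ψ).card) := by
  induction m generalizing φ v dec with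
  | zero => exact .ret _ _ _ trivial
  | succ m ih =>
    have hcard : 5 * n * ((Finset.Ico φ (φ + (m + 1))).filter fun ψ => i ∈ block c k ψ).card =
        (if i ∈ block c k φ then 5 * n else 0) +
        5 * n * ((Finset.Ico (φ + 1) (φ + 1 + m)).filter fun ψ => i ∈ block c k ψ).card := by
      rw [← Finset.insert_Ico_add_one_left_eq_Ico (by omega : φ < φ + (m + 1)),
        Finset.filter_insert, show φ + (m + 1) = φ + 1 + m by omega]
      split_ifs
      · rw [Finset.card_insert_of_notMem (by simp)]
        ring
      · ring
    rw [hcard, show 5 * (m + 1) = 5 + 5 * m by ring]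
    refine haltsWithin_phases_step fun b => ?_
    cases dec with
    | none => exact ih _ _ _
    | some d => exact .ret _ _ _ trivial

/-- The result does not depend on the messages received. This is needed for late deciders, whose
last phase may run after other honest processes have already returned. -/
theorem haltsWithin_phases_decided (c : Fin n → Bool) (pick : ℕ → Set V → V) (m φ : ℕ) (v : V) :
    ∃ T N, HaltsWithin (· = v) (phases i c k pick m φ v (some v)) T N := by
  cases m with
  | zero => exact ⟨0, 0, .ret _ _ _ rfl⟩
  | succ m => exact ⟨_, _, haltsWithin_phases_step (T := 0) (N := 0) fun b => .ret _ _ _ rfl⟩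

end Cost

/-! ### Lockstep execution of one round -/

section Rounds

variable {n : ℕ} {M : Type u} {α : Type v} {prog : Fin n → Program n M α} {H : Finset (Fin n)}
  {adv : ℕ → Fin n → Fin n → Option M} {r : ℕ}

/-- All that is retained of the adversary is an inbox whose honest entries are as prescribed; the
other entries are arbitrary. -/
theorem stateAfter_exchange_bind {send : Fin n → Fin n → Option M}
    {f : Fin n → (Fin n → Option M) → Program n M α}
    (h : ∀ i ∈ H, stateAfter prog H adv r i = (exchange (send i)).bind (f i)) :
    ∃ R : Fin n → Fin n → Option M, (∀ i, ∀ j ∈ H, R i j = send j i) ∧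
      ∀ i ∈ H, stateAfter prog H adv (r + 1) i = f i (R i) := by
  refine ⟨received prog H adv r, fun i j hj => ?_, fun i hi => ?_⟩
  · rw [received, if_pos hj, h j hj]
    rfl
  · rw [stateAfter_succ, h i hi]
    rfl

end Rounds

/-! ### Graded consensus with a core -/

section GradedConsensus

variable {n : ℕ} {V : Type u} {H C : Finset (Fin n)} {k : ℕ} {L : Fin n → Finset (Fin n)}

/-- At most k members of the listening set fail `p`, hence at most k core members do. -/
theorem IsCore.card_core_le_add {p : Fin n → Prop} [DecidablePred p] (hC : IsCore H k L C)
    {i : Fin n} (hi : i ∈ H) (hp : 2 * k + 1 ≤ ((L i).filter p).card) :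
    C.card ≤ (C.filter p).card + k := by
  have h1 : ((L i).filter p).card ≤ (C.filter p).card + (L i \ C).card := by
    refine (Finset.card_le_card fun j hj => ?_).trans (Finset.card_union_le _ _)
    simp only [Finset.mem_union, Finset.mem_filter, Finset.mem_sdiff] at hj ⊢
    tauto
  rw [Finset.card_sdiff_of_subset (hC.subset_listen i hi)] at h1
  have h2 := hC.card_listen_le i hi
  have h3 := Finset.card_le_card (hC.subset_listen i hi)
  omega

/-- Each property fails on at most k core members, and the core has more than 2k. -/
theorem IsCore.exists_mem_core_and {p q : Fin n → Prop} [DecidablePred p] [DecidablePred q]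
    (hC : IsCore H k L C) {i j : Fin n} (hi : i ∈ H) (hj : j ∈ H)
    (hp : 2 * k + 1 ≤ ((L i).filter p).card) (hq : 2 * k + 1 ≤ ((L j).filter q).card) :
    ∃ y ∈ C, p y ∧ q y := by
  by_contra! hne
  have h1 := hC.card_core_le_add hi hp
  have h2 := hC.card_core_le_add hj hq
  have h3 : (C.filter p).card + (C.filter q).card ≤ C.card := by
    rw [← Finset.card_union_of_disjoint]
    · exact Finset.card_le_card
        (Finset.union_subset (Finset.filter_subset _ _) (Finset.filter_subset _ _))
    · rw [Finset.disjoint_filter]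
      exact hne
  have h4 := hC.le_card
  omega

theorem IsCore.exists_mem_honest {p : Fin n → Prop} [DecidablePred p]
    (hC : IsCore H k L C) {i : Fin n} (hi : i ∈ H) (hp : k + 1 ≤ ((L i).filter p).card) :
    ∃ y ∈ H, p y := by
  by_contra! hne
  have h1 := hC.card_faulty_le i hi
  have h2 : (L i).filter p ⊆ L i \ H := by
    intro y hy
    rw [Finset.mem_filter] at hy
    exact Finset.mem_sdiff.2 ⟨hy.1, fun h => hne y h hy.2⟩
  have h3 := Finset.card_le_card h2
  omega

theorem IsCore.nonempty (hC : IsCore H k L C) : C.Nonempty := by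
  rw [← Finset.card_pos]
  have := hC.le_card
  omega

open Classical in
/-- The value that a process locks in the first round of graded consensus. -/
noncomputable def lockedValue (k : ℕ) (L : Finset (Fin n)) (pick : Set V → V)
    (R : Fin n → Option (Msg n V)) : Option V :=
  if {w | 2 * k + 1 ≤ occurrences L R w}.Nonempty then
    some (pick {w | 2 * k + 1 ≤ occurrences L R w}) else none

/-- The messages sent in the second round of graded consensus. -/
def lockedMessages (i : Fin n) (L : Finset (Fin n)) : Option V → Fin n → Option (Msg n V)
  | some w => broadcastIfMem i L (Msg.value w)
  | none => fun _ => none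

open Classical in
/-- The result of graded consensus, given the locked value and the messages received in the second
round. -/
noncomputable def gradedResult (k : ℕ) (L : Finset (Fin n)) (pick : Set V → V) (v : V)
    (R' : Fin n → Option (Msg n V)) : Option V → V × Bool
  | some w => (w, decide (2 * k + 1 ≤ occurrences L R' w))
  | none => if {w | k + 1 ≤ occurrences L R' w}.Nonempty then
      (pick {w | k + 1 ≤ occurrences L R' w}, false) else (v, false)

theorem gradedConsensus_eq (i : Fin n) (L : Finset (Fin n)) (p₁ p₂ : Set V → V) (v : V) :
    gradedConsensus i k L p₁ p₂ v =
      (exchange (broadcastIfMem i L (Msg.value v))).bind fun R =>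
        (exchange (lockedMessages i L (lockedValue k L p₁ R))).bind fun R' =>
          .ret (gradedResult k L p₂ v R' (lockedValue k L p₁ R)) := by
  unfold gradedConsensus
  refine congrArg (Program.bind _) (funext fun R => ?_)
  change (exchange _).bind _ = _
  change (exchange (match lockedValue k L p₁ R with
    | some w => broadcastIfMem i L (Msg.value w)
    | none => fun _ => none)).bind (fun R' => match lockedValue k L p₁ R with
      | some w => _
      | none => _) = _
  cases lockedValue k L p₁ R with
  | some w => rfl
  | none =>
    refine congrArg (Program.bind _) (funext fun R' => ?_)
    dsimp only [gradedResult]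
    split_ifs <;> rfl

variable {v : Fin n → V} {R R' : Fin n → Fin n → Option (Msg n V)} {pick₁ pick₂ : Fin n → Set V → V}

theorem le_occurrences_of_lockedValue {p : Set V → V} (hp : IsChoice p) {L : Finset (Fin n)}
    {R : Fin n → Option (Msg n V)} {w : V} (h : lockedValue k L p R = some w) :
    2 * k + 1 ≤ occurrences L R w := by
  unfold lockedValue at h
  split_ifs at h with hS
  rw [← Option.some.inj h]
  exact hp _ hS

open Classical in
theorem lockedValue_unanimous (hC : IsCore H k L C) (hp : ∀ i, IsChoice (pick₁ i))
    (hR : ∀ i, ∀ j ∈ H, R i j = broadcastIfMem j (L j) (Msg.value (v j)) i) {a : V}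
    (hv : ∀ i ∈ H, v i = a) {i : Fin n} (hi : i ∈ H) :
    lockedValue k (L i) (pick₁ i) (R i) = some a := by
  have hsend : ∀ j ∈ C, R i j = some (Msg.value a) := by
    intro j hj
    have hjH := hC.subset_honest hj
    rw [hR i j hjH, broadcastIfMem, if_pos (hC.subset_listen j hjH hj), hv j hjH]
  have ha : 2 * k + 1 ≤ occurrences (L i) (R i) a :=
    hC.le_card.trans (Finset.card_le_card fun j hj =>
      Finset.mem_filter.2 ⟨hC.subset_listen i hi hj, hsend j hj⟩)
  cases h : lockedValue k (L i) (pick₁ i) (R i) with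
  | none =>
    unfold lockedValue at h
    rw [if_pos ⟨a, ha⟩] at h
    exact absurd h (by simp)
  | some w =>
    -- The choice function might select another value with a quorum, but both quorums share a sender
    -- in the same inbox.
    obtain ⟨y, -, h1, h2⟩ := hC.exists_mem_core_and hi hi ha
      (le_occurrences_of_lockedValue (hp i) h)
    rw [h1] at h2
    simpa using h2.symm

open Classical in
theorem lockedValue_agree (hC : IsCore H k L C) (hp : ∀ i, IsChoice (pick₁ i))
    (hR : ∀ i, ∀ j ∈ H, R i j = broadcastIfMem j (L j) (Msg.value (v j)) i)
    {i j : Fin n} (hi : i ∈ H) (hj : j ∈ H) {w w' : V}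
    (h : lockedValue k (L i) (pick₁ i) (R i) = some w)
    (h' : lockedValue k (L j) (pick₁ j) (R j) = some w') : w = w' := by
  obtain ⟨y, hy, h1, h2⟩ := hC.exists_mem_core_and hi hj
    (le_occurrences_of_lockedValue (hp i) h) (le_occurrences_of_lockedValue (hp j) h')
  have hyH := hC.subset_honest hy
  rw [hR _ y hyH, broadcastIfMem, if_pos (hC.subset_listen y hyH hy)] at h1 h2
  rw [h1] at h2
  simpa using h2

theorem lockedMessages_eq_some_iff {i j : Fin n} {L : Finset (Fin n)} {b : Option V} {w : V} :
    lockedMessages i L b j = some (Msg.value w) ↔ i ∈ L ∧ b = some w := by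
  cases b <;> simp [lockedMessages, broadcastIfMem]

open Classical in
theorem gradedResult_unanimous (hC : IsCore H k L C) {b : Fin n → Option V}
    (hR : ∀ i, ∀ j ∈ H, R' i j = lockedMessages j (L j) (b j) i) {a : V}
    (hb : ∀ i ∈ H, b i = some a) {i : Fin n} (hi : i ∈ H) :
    gradedResult k (L i) (pick₂ i) (v i) (R' i) (b i) = (a, true) := by
  have ha : 2 * k + 1 ≤ occurrences (L i) (R' i) a :=
    hC.le_card.trans (Finset.card_le_card fun j hj => by
      have hjH := hC.subset_honest hj
      refine Finset.mem_filter.2 ⟨hC.subset_listen i hi hj, ?_⟩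
      rw [hR i j hjH, lockedMessages_eq_some_iff]
      exact ⟨hC.subset_listen j hjH hj, hb j hjH⟩)
  rw [hb i hi]
  simp [gradedResult, ha]

open Classical in
theorem gradedResult_coherent (hC : IsCore H k L C) (hp : ∀ i, IsChoice (pick₂ i))
    {b : Fin n → Option V} (hR : ∀ i, ∀ j ∈ H, R' i j = lockedMessages j (L j) (b j) i)
    (hb : ∀ i ∈ H, ∀ j ∈ H, ∀ w w', b i = some w → b j = some w' → w = w')
    {i j : Fin n} (hi : i ∈ H) (hj : j ∈ H)
    (h : (gradedResult k (L i) (pick₂ i) (v i) (R' i) (b i)).2 = true) :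
    (gradedResult k (L j) (pick₂ j) (v j) (R' j) (b j)).1 =
      (gradedResult k (L i) (pick₂ i) (v i) (R' i) (b i)).1 := by
  cases hbi : b i with
  | none =>
    rw [hbi] at h
    simp only [gradedResult] at h
    split_ifs at h
  | some a =>
    rw [hbi] at h
    have hocc : 2 * k + 1 ≤ occurrences (L i) (R' i) a := by simpa [gradedResult] using h
    change _ = a
    cases hbj : b j with
    | some w => exact hb j hj i hi _ _ hbj hbi
    | none =>
      -- At least k+1 core members sent `a` to `i`, and they sent it to `j` too. Whatever `j` then
      -- picks has k+1 senders, one of them honest, and an honest sender can have locked only `a`.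
      have h1 := hC.card_core_le_add hi hocc
      have h2 := hC.le_card
      have ha : k + 1 ≤ occurrences (L j) (R' j) a := by
        refine le_trans (by omega) (Finset.card_le_card
          (s := C.filter fun y => R' i y = some (Msg.value a)) fun y hy => ?_)
        obtain ⟨hyC, hy⟩ := Finset.mem_filter.1 hy
        refine Finset.mem_filter.2 ⟨hC.subset_listen j hj hyC, ?_⟩
        rw [hR _ y (hC.subset_honest hyC), lockedMessages_eq_some_iff] at hy ⊢
        exact hy
      have hne : {w | k + 1 ≤ occurrences (L j) (R' j) w}.Nonempty := ⟨a, ha⟩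
      have hpick := hp j _ hne
      obtain ⟨y, hyH, hy⟩ := hC.exists_mem_honest hj hpick
      rw [hR _ y hyH, lockedMessages_eq_some_iff] at hy
      simp only [gradedResult, if_pos hne]
      exact hb y hyH i hi _ _ hy.2 hbi

variable {α : Type v} {prog : Fin n → Program n (Msg n V) α}
  {adv : ℕ → Fin n → Fin n → Option (Msg n V)} {r : ℕ}

theorem Program.bind_assoc {M : Type*} {α β γ : Type*}
    (p : Program n M α) (f : α → Program n M β) (g : β → Program n M γ) :
    (p.bind f).bind g = p.bind fun a => (f a).bind g := by
  induction p with
  | ret a => rfl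
  | round send next ih => simp only [Program.bind, ih]

/-- Graded consensus with a core satisfies strong unanimity and coherence. -/
theorem stateAfter_gradedConsensus (hC : IsCore H k L C) (hp₁ : ∀ i, IsChoice (pick₁ i))
    (hp₂ : ∀ i, IsChoice (pick₂ i)) {f : Fin n → V × Bool → Program n (Msg n V) α}
    (h : ∀ i ∈ H, stateAfter prog H adv r i =
      (gradedConsensus i k (L i) (pick₁ i) (pick₂ i) (v i)).bind (f i)) :
    ∃ out : Fin n → V × Bool, (∀ i ∈ H, stateAfter prog H adv (r + 2) i = f i (out i)) ∧
      (∀ a, (∀ i ∈ H, v i = a) → ∀ i ∈ H, out i = (a, true)) ∧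
      ∀ i ∈ H, (out i).2 = true → ∀ j ∈ H, (out j).1 = (out i).1 := by
  simp only [gradedConsensus_eq, Program.bind_assoc] at h
  obtain ⟨R, hR, h'⟩ := stateAfter_exchange_bind h
  obtain ⟨R', hR', h''⟩ := stateAfter_exchange_bind h'
  refine ⟨_, h'', fun a ha i hi => ?_, fun i hi hg j hj => ?_⟩
  · exact gradedResult_unanimous hC hR' (fun i hi => lockedValue_unanimous hC hp₁ hR ha hi) hi
  · exact gradedResult_coherent hC hp₂ hR'
      (fun i hi j hj w w' h1 h2 => lockedValue_agree hC hp₁ hR hi hj h1 h2) hi hj hg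

end GradedConsensus

/-! ### Conciliation in a clean phase -/

section Conciliation

variable {n : ℕ} {V : Type u} {H C : Finset (Fin n)} {k : ℕ} {L : Fin n → Finset (Fin n)}

/-- Followed backwards from an honest endpoint, a path stays among honest processes, because every
set sent by one of them lies in `H`. Its edges then depend only on honest messages, which the two
inboxes share. -/
theorem mem_and_reachable_of_reachable {R R' : Fin n → Option (Msg n V)}
    (hR : ∀ y ∈ H, R y = R' y)
    (hL : ∀ z ∈ H, ∀ v A, R z = some (Msg.proposal v A) → A ⊆ H) {y z : Fin n} (hz : z ∈ H)
    (h : Relation.ReflTransGen (LeaderEdge R) y z) :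
    y ∈ H ∧ Relation.ReflTransGen (LeaderEdge R') y z := by
  induction h using Relation.ReflTransGen.head_induction_on with
  | refl => exact ⟨hz, .refl⟩
  | head hedge _ ih =>
    obtain ⟨⟨v, A, h1⟩, v', A', h2, h3⟩ := hedge
    have hy := hL _ ih.1 v' A' h2 h3
    refine ⟨hy, .head ⟨⟨v, A, ?_⟩, v', A', ?_, h3⟩ ih.2⟩
    · rw [← hR _ hy, h1]
    · rw [← hR _ ih.1, h2]

theorem reachingValues_subset {R R' : Fin n → Option (Msg n V)} (hR : ∀ y ∈ H, R y = R' y)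
    (hL : ∀ z ∈ H, ∀ v A, R z = some (Msg.proposal v A) → A ⊆ H) {z : Fin n} (hz : z ∈ H) :
    reachingValues R z ⊆ {v | ∃ y ∈ H, ∃ A, R y = some (Msg.proposal v A)} ∩
      reachingValues R' z := by
  rintro v ⟨y, A, hy, hyA, hpath⟩
  have key := mem_and_reachable_of_reachable hR hL hz hpath
  exact ⟨⟨y, key.1, A, hy⟩, y, A, hR y key.1 ▸ hy, hyA, key.2⟩

theorem reachingValues_subset_of_edge {R : Fin n → Option (Msg n V)} {y z : Fin n}
    (h : LeaderEdge R y z) : reachingValues R y ⊆ reachingValues R z := by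
  rintro v ⟨x, A, h1, h2, h3⟩
  exact ⟨x, A, h1, h2, h3.tail h⟩

variable [LinearOrder V] {v : Fin n → V} {R : Fin n → Fin n → Option (Msg n V)}
  {pick : Fin n → Set V → V}

/-- Any two core members are joined by an edge, since the core lies in every honest listening set.
So the reaching values are the same for all core members and all honest receivers. -/
theorem exists_isLeast_reachingValues (hC : IsCore H k L C) (hL : ∀ i ∈ H, L i ⊆ H)
    (hR : ∀ i, ∀ j ∈ H, R i j = broadcastIfMem j (L j) (Msg.proposal (v j) (L j)) i) :
    ∃ y ∈ H, ∀ i ∈ H, ∀ z ∈ C, IsLeast (reachingValues (R i) z) (v y) := by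
  have hsame : ∀ i ∈ H, ∀ j ∈ H, ∀ y ∈ H, R i y = R j y := by
    intro i _ j _ y hy
    rw [hR i y hy, hR j y hy]
    rfl
  have hcl : ∀ i ∈ H, ∀ z ∈ H, ∀ w A, R i z = some (Msg.proposal w A) → w = v z ∧ A = L z := by
    intro i _ z hz w A h
    rw [hR i z hz, broadcastIfMem] at h
    split_ifs at h
    simp only [Option.some.injEq, Msg.proposal.injEq] at h
    exact ⟨h.1.symm, h.2.symm⟩
  have hcl' : ∀ i ∈ H, ∀ z ∈ H, ∀ w A, R i z = some (Msg.proposal w A) → A ⊆ H :=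
    fun i hi z hz w A h => (hcl i hi z hz w A h).2 ▸ hL z hz
  have hcore : ∀ i, ∀ z ∈ C, R i z = some (Msg.proposal (v z) (L z)) := by
    intro i z hz
    have hzH := hC.subset_honest hz
    rw [hR i z hzH, broadcastIfMem, if_pos (hC.subset_listen z hzH hz)]
  have hsub : ∀ i ∈ H, ∀ j ∈ H, ∀ z ∈ C, ∀ z' ∈ C,
      reachingValues (R i) z ⊆ reachingValues (R j) z' := by
    intro i hi j hj z hz z' hz'
    refine ((reachingValues_subset (hsame i hi j hj) (hcl' i hi) (hC.subset_honest hz)).trans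
      Set.inter_subset_right).trans (reachingValues_subset_of_edge ?_)
    exact ⟨⟨_, _, hcore j z hz⟩, _, _, hcore j z' hz', hC.subset_listen z' (hC.subset_honest hz') hz⟩
  obtain ⟨z, hz⟩ := hC.nonempty
  have hzH := hC.subset_honest hz
  have hrange : reachingValues (R z) z ⊆ v '' H := by
    intro w hw
    obtain ⟨y, hy, A, h⟩ :=
      (reachingValues_subset (hsame z hzH z hzH) (hcl' z hzH) hzH hw).1
    exact ⟨y, hy, (hcl z hzH y hy w A h).1.symm⟩
  -- The minimum exists: the set lies in the finite set of honest values, and it contains the value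
  -- of `z` by the path of length 0.
  obtain ⟨a, ha, hmin⟩ := Set.exists_min_image (reachingValues (R z) z) id
    ((H.finite_toSet.image v).subset hrange)
    ⟨v z, z, L z, hcore z z hz, hC.subset_listen z hzH hz, .refl⟩
  obtain ⟨y, hy, rfl⟩ := hrange ha
  exact ⟨y, hy, fun i hi z' hz' => ⟨hsub z hzH i hi z hz z' hz' ha,
    fun w hw => hmin w (hsub i hi z hzH z' hz' z hz hw)⟩⟩

open Classical in
/-- If the listening sets contain no faulty processes, then conciliation leads to agreement on the
input of some honest process. -/
theorem pick_minOccurrences (hC : IsCore H k L C) (hL : ∀ i ∈ H, L i ⊆ H)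
    (hp : ∀ i, IsChoice (pick i))
    (hR : ∀ i, ∀ j ∈ H, R i j = broadcastIfMem j (L j) (Msg.proposal (v j) (L j)) i) :
    ∃ y ∈ H, ∀ i ∈ H, pick i {w | 0 < minOccurrences (L i) (R i) w ∧
      ∀ u, minOccurrences (L i) (R i) u ≤ minOccurrences (L i) (R i) w} = v y := by
  obtain ⟨y, hy, hleast⟩ := exists_isLeast_reachingValues hC hL hR
  refine ⟨y, hy, fun i hi => ?_⟩
  have hcard := hC.le_card
  have hge : C.card ≤ minOccurrences (L i) (R i) (v y) := by
    refine Finset.card_le_card fun z hz => ?_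
    have hzH := hC.subset_honest hz
    refine Finset.mem_filter.2 ⟨hC.subset_listen i hi hz, ⟨v z, L z, ?_⟩, hleast i hi z hz⟩
    rw [hR i z hzH, broadcastIfMem, if_pos (hC.subset_listen z hzH hz)]
  -- Only the at most k listeners outside a core of size at least 2k+1 can vote for another value.
  have hlt : ∀ u, u ≠ v y → minOccurrences (L i) (R i) u < minOccurrences (L i) (R i) (v y) := by
    intro u hu
    have h1 : minOccurrences (L i) (R i) u ≤ (L i \ C).card := by
      refine Finset.card_le_card fun z hz => ?_
      obtain ⟨hzL, -, hz⟩ := Finset.mem_filter.1 hz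
      exact Finset.mem_sdiff.2 ⟨hzL, fun hzC => hu (hz.unique (hleast i hi z hzC))⟩
    rw [Finset.card_sdiff_of_subset (hC.subset_listen i hi)] at h1
    have h2 := hC.card_listen_le i hi
    omega
  have hmem := hp i {w | 0 < minOccurrences (L i) (R i) w ∧
      ∀ u, minOccurrences (L i) (R i) u ≤ minOccurrences (L i) (R i) w} ⟨v y, by omega, fun u => by
    by_cases hu : u = v y
    · rw [hu]
    · exact (hlt u hu).le⟩
  by_contra hne
  exact absurd (hmem.2 (v y)) (not_le.2 (hlt _ hne))

variable {α : Type v} {prog : Fin n → Program n (Msg n V) α}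
  {adv : ℕ → Fin n → Fin n → Option (Msg n V)} {r : ℕ}

theorem stateAfter_conciliate (hC : IsCore H k L C) (hp : ∀ i, IsChoice (pick i))
    {f : Fin n → V → Program n (Msg n V) α}
    (h : ∀ i ∈ H, stateAfter prog H adv r i = (conciliate i (L i) (pick i) (v i)).bind (f i)) :
    ∃ out : Fin n → V, (∀ i ∈ H, stateAfter prog H adv (r + 1) i = f i (out i)) ∧
      ((∀ i ∈ H, L i ⊆ H) → ∃ y ∈ H, ∀ i ∈ H, out i = v y) := by
  have h' : ∀ i ∈ H, stateAfter prog H adv r i =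
      (exchange (broadcastIfMem i (L i) (Msg.proposal (v i) (L i)))).bind fun R =>
        f i (pick i {w | 0 < minOccurrences (L i) R w ∧
          ∀ u, minOccurrences (L i) R u ≤ minOccurrences (L i) R w}) := h
  obtain ⟨R, hR, h''⟩ := stateAfter_exchange_bind h'
  exact ⟨_, h'', fun hL => pick_minOccurrences hC hL hp hR⟩

end Conciliation

/-! ### Phases and agreement -/

section Phases

variable {n : ℕ} {V : Type u} [LinearOrder V] {H C : Finset (Fin n)} {k : ℕ} {v : Fin n → V}
  {c : Fin n → Fin n → Bool} {pick : Fin n → ℕ → Set V → V} {dec : Fin n → Option V}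
  {prog : Fin n → Program n (Msg n V) V}
  {adv : ℕ → Fin n → Fin n → Option (Msg n V)} {r m φ : ℕ}

/-- One phase, in which all honest processes take part. -/
theorem stateAfter_phase (hC : IsCore H k (fun i => block (c i) k φ) C)
    (hp : ∀ i r, IsChoice (pick i r))
    (h : ∀ i ∈ H, stateAfter prog H adv r i =
      phases i (c i) k (pick i) (m + 1) φ (v i) (dec i)) :
    ∃ b : Fin n → V × Bool,
      (∀ i ∈ H, stateAfter prog H adv (r + 5) i = match dec i with
        | some d => .ret d
        | none => phases i (c i) k (pick i) m (φ + 1) (b i).1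
            (if (b i).2 = true then some (b i).1 else none)) ∧
      (∀ a, (∀ i ∈ H, v i = a) → ∀ i ∈ H, b i = (a, true)) ∧
      (∀ i ∈ H, (b i).2 = true → ∀ j ∈ H, (b j).1 = (b i).1) ∧
      ((∀ i ∈ H, block (c i) k φ ⊆ H) → ∀ i ∈ H, (b i).2 = true) := by
  obtain ⟨a, h₁, hunan, hcoh⟩ := stateAfter_gradedConsensus hC (fun i => hp i (5 * φ))
    (fun i => hp i (5 * φ + 1)) h
  obtain ⟨v', h₂, hconc⟩ := stateAfter_conciliate hC (fun i => hp i (5 * φ + 2)) h₁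
  obtain ⟨b, h₃, hunan', hcoh'⟩ := stateAfter_gradedConsensus hC (fun i => hp i (5 * φ + 3))
    (fun i => hp i (5 * φ + 4)) h₂
  refine ⟨b, fun i hi => ?_, fun w hw i hi => ?_, hcoh', fun hL i hi => ?_⟩
  · rw [show r + 5 = r + 2 + 1 + 2 by omega, h₃ i hi]
    cases dec i <;> rfl
  · refine hunan' w (fun j hj => ?_) i hi
    rw [hunan w hw j hj]
    rfl
  · obtain ⟨y, hy, hv'⟩ := hconc hL
    rw [hunan' (a y).1 (fun j hj => ?_) i hi]
    split_ifs with hg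
    · exact (hcoh j hj hg y hy).symm
    · exact hv' j hj

/-- Processes that have already decided still take part in this phase, so the core is intact and all
others decide `a` in it. -/
theorem exists_ret_of_unanimous
    (hC : ∀ φ < 2 * k + 1, ∃ C, IsCore H k (fun i => block (c i) k φ) C)
    (hp : ∀ i r, IsChoice (pick i r)) (hm : φ + m = 2 * k + 1) {a : V}
    (hdec : ∀ i ∈ H, ∀ d ∈ dec i, d = a)
    (h : ∀ i ∈ H, stateAfter prog H adv r i = phases i (c i) k (pick i) m φ a (dec i)) :
    ∀ i ∈ H, ∃ r, stateAfter prog H adv r i = .ret a := by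
  intro i hi
  cases m with
  | zero => exact ⟨r, h i hi⟩
  | succ m =>
    obtain ⟨C, hC⟩ := hC φ (by omega)
    obtain ⟨b, hb, hunan, -, -⟩ := stateAfter_phase (v := fun _ => a) hC hp h
    have hbi := hb i hi
    cases hd : dec i with
    | some d =>
      rw [hd, hdec i hi d (by rw [hd]; rfl)] at hbi
      exact ⟨_, hbi⟩
    | none =>
      rw [hd, hunan a (fun _ _ => rfl) i hi] at hbi
      obtain ⟨T, N, hT⟩ := haltsWithin_phases_decided (i := i) (k := k) (c i) (pick i) m (φ + 1) a
      have hbi' : stateAfter prog H adv (r + 5) i =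
        phases i (c i) k (pick i) m (φ + 1) a (some a) := hbi
      rw [← hbi'] at hT
      obtain ⟨s, -, w, rfl, hs⟩ := HaltsWithin.exists_output hT
      exact ⟨_, hs⟩

theorem exists_ret_agreement (hH : H.Nonempty)
    (hC : ∀ φ < 2 * k + 1, ∃ C, IsCore H k (fun i => block (c i) k φ) C)
    (hp : ∀ i r, IsChoice (pick i r)) (hm : φ + m = 2 * k + 1)
    (hclean : ∃ ψ, φ ≤ ψ ∧ ψ < 2 * k + 1 ∧ ∀ i ∈ H, block (c i) k ψ ⊆ H)
    (h : ∀ i ∈ H, stateAfter prog H adv r i = phases i (c i) k (pick i) m φ (v i) none) :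
    ∃ a, ∀ i ∈ H, ∃ r, stateAfter prog H adv r i = .ret a := by
  induction m generalizing φ r v with
  | zero =>
    obtain ⟨ψ, h1, h2, -⟩ := hclean
    omega
  | succ m ih =>
    obtain ⟨C, hCφ⟩ := hC φ (by omega)
    obtain ⟨b, hb, -, hcoh, hgood⟩ := stateAfter_phase (dec := fun _ => none) hCφ hp h
    by_cases hg : ∃ i ∈ H, (b i).2 = true
    · obtain ⟨i, hi, hgi⟩ := hg
      -- By coherence every decision made in this phase equals the value of `i`, which is also
      -- everyone's value for the next phase.
      refine ⟨(b i).1, exists_ret_of_unanimous (m := m) (φ := φ + 1) (r := r + 5)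
        (dec := fun j => if (b j).2 = true then some (b i).1 else none) hC hp (by omega) ?_ ?_⟩
      · intro j _ d hd
        split_ifs at hd
        · exact (Option.some.inj hd).symm
        · exact absurd hd (by simp)
      · intro j hj
        rw [hb j hj, hcoh i hi hgi j hj]
    · push Not at hg
      -- Nobody decided, so all continue undecided; the current phase was not the clean one, which
      -- therefore still lies ahead.
      refine ih (φ := φ + 1) (r := r + 5) (v := fun i => (b i).1) (by omega) ?_ fun i hi => ?_
      · obtain ⟨ψ, h1, h2, h3⟩ := hclean
        refine ⟨ψ, Nat.lt_of_le_of_ne h1 ?_, h2, h3⟩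
        rintro rfl
        obtain ⟨i, hi⟩ := hH
        exact hg i hi (hgood h3 i hi)
      · rw [hb i hi]
        simp [hg i hi]

end Phases

end ByzAgreement

/-! ### The main theorem -/

theorem theorem6p12 :
    ∃ C : ℕ, ∀ (V : Type u) [LinearOrder V] (n t k : ℕ)
      (H : Finset (Fin n)) (x : Fin n → V) (c : Fin n → Fin n → Bool)
      (pick : Fin n → ℕ → Set V → V) (adv : ℕ → Fin n → Fin n → Option (Msg n V)),
      Hᶜ.card ≤ t →
      (∀ i r, IsChoice (pick i r)) →
      ((misclassified H c).card ≤ k →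
        (2 * (k : ℤ) + 1) * (3 * k + 1) ≤ n - t - k →
          Agreement (baSystem k pick x c) H adv ∧
          StrongUnanimity x (baSystem k pick x c) H adv ∧
          ∑ i ∈ H, messagesSent (baSystem k pick x c) H adv i ≤ C * n * max k 1 ^ 2) ∧
      ∀ i ∈ H,
        (∃ r ≤ 5 * (2 * k + 1), ∃ a, ReturnsBy (baSystem k pick x c) H adv r i a) ∧
        messagesSent (baSystem k pick x c) H adv i ≤ 5 * n := by
  -- 65 = 5 · 13: each sender sends at most 5n messages, and with q = max(k,1) there are at most 6k²
  -- + 6k + 1 ≤ 13q² senders.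
  refine ⟨65, fun V _ n t k H x c pick adv ht hp => ?_⟩
  have hhalt := fun i => haltsWithin_phases (i := i) (k := k) (c i) (pick i) (2 * k + 1) 0 (x i) none
  simp only [zero_add, ← Finset.range_eq_Ico] at hhalt
  have hmsg : ∀ i, messagesSent (baSystem k pick x c) H adv i ≤
      (5 * n * ((Finset.range (2 * k + 1)).filter fun φ => i ∈ block (c i) k φ).card : ℕ) :=
    fun i => HaltsWithin.messagesSent_le (hhalt i)
  have hmsg' : ∀ i, messagesSent (baSystem k pick x c) H adv i ≤ 5 * n := fun i =>
    (hmsg i).trans (by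
      have := Nat.mul_le_mul_left (5 * n)
        (card_filter_mem_block_le_one (c i) k i (Finset.range (2 * k + 1)))
      rw [mul_one] at this
      exact_mod_cast this)
  refine ⟨fun hk hn => ?_, fun i hi => ⟨?_, hmsg' i⟩⟩
  · have hA := le_card_sdiff_misclassified ht hk hn
    have hC := fun φ hφ => exists_isCore (φ := φ) hk hA hφ
    have hH : H.Nonempty := by
      obtain ⟨C, hC⟩ := hC 0 (by omega)
      exact hC.nonempty.mono hC.subset_honest
    refine ⟨?_, fun a ha i hi => ?_, ?_⟩
    · obtain ⟨ψ, hψ, hclean⟩ := exists_phase_block_subset hk hA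
      obtain ⟨a, ha⟩ := exists_ret_agreement (prog := baSystem k pick x c) (adv := adv) (r := 0)
        (v := x) hH hC hp (Nat.zero_add _) ⟨ψ, Nat.zero_le _, hψ, hclean⟩ fun i hi => rfl
      exact ⟨a, fun i hi => (ha i hi).elim fun r hr => ⟨r, congrArg Program.output hr⟩⟩
    · obtain ⟨r, hr⟩ := exists_ret_of_unanimous (prog := baSystem k pick x c) (adv := adv) (r := 0)
        (dec := fun _ => none) (a := a) hC hp (Nat.zero_add _) (by simp)
        (fun i hi => by rw [← ha i hi]; rfl) i hi
      exact ⟨r, congrArg Program.output hr⟩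
    · have hcard := card_filter_mem_block_le hk hA
      -- Processes that are in none of their own blocks send nothing and drop out of the sum.
      rw [← Finset.sum_filter_of_ne (p := fun i => ∃ φ < 2 * k + 1, i ∈ block (c i) k φ)]
      · refine (Finset.sum_le_card_nsmul _ _ _ fun i _ => hmsg' i).trans ?_
        have hnat : (H.filter fun i => ∃ φ < 2 * k + 1, i ∈ block (c i) k φ).card * (5 * n) ≤
            65 * n * max k 1 ^ 2 := by
          refine (Nat.mul_le_mul_right _ hcard).trans ?_
          have h1 : k ≤ max k 1 := le_max_left _ _
          have h2 : 1 ≤ max k 1 := le_max_right _ _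
          generalize max k 1 = q at h1 h2
          have h3 : (2 * k + 1) * (3 * k + 1) + k ≤ 13 * q ^ 2 := by nlinarith
          nlinarith
        rw [nsmul_eq_mul]
        exact_mod_cast hnat
      · intro i _ hne
        by_contra hnot
        push Not at hnot
        refine hne (le_antisymm ((hmsg i).trans ?_) zero_le)
        rw [Finset.filter_eq_empty_iff.2 fun φ hφ => hnot φ (Finset.mem_range.1 hφ)]
        simp
  · obtain ⟨s, hs, a, -, h⟩ := HaltsWithin.exists_output (prog := baSystem k pick x c) (H := H)
      (adv := adv) (r := 0) (hhalt i)
    rw [Nat.zero_add] at h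
    exact ⟨s, hs, a, congrArg Program.output h⟩
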